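/- Let $M$ be a smooth $n$-dimensional Riemannian manifold with Levi-Civita connection $\overline\nabla$, let $\Sigma\subseteq M$ be a subset, and let $m\ge 0$ be an integer. Let $\Sigma_0\subseteq\Sigma$ be the set of points of $\Sigma$ near which $\Sigma$ is a twice differentiable embedded $m$-dimensional submanifold of $M$, i.e. which have a relatively open neighbourhood in $\Sigma$ that is the homeomorphic image of an open subset of $\mathbb R^m$ under a twice differentiable immersion. Call $\Sigma$ helicoidal in $M$ if for every $\bar p\in\Sigma$ there is a Riemannian isometry $\varphi$ of $M$ such that $$\varphi(\bar p)=\bar p,\qquad \varphi(\Sigma)=\Sigma,\qquad\text{and, if }\bar p\in\Sigma_0,\quad \varphi_*(v)=-v\ \text{ for every } v\in T_{\bar p}M \text{ with } v\perp T_{\bar p}\Sigma_0 .$$ (Neither completeness of $M$ nor any condition on the size of $\Sigma\setminus\Sigma_0$ is required.) If $\Sigma$ is helicoidal in $M$, then $\Sigma$ is minimal at every point of $\Sigma_0$: its mean curvature vector $$\vec H=\sum_{i=1}^m(\overline\nabla_{e_i}e_i)^\perp ,$$ the trace of the second fundamental form, where $e_1,\dots,e_m$ is a local orthonormal tangent frame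 of $\Sigma_0$ and $\perp$ denotes the component normal to $\Sigma_0$, vanishes at every point of $\Sigma_0$. -/

import Mathlib

open scoped Manifold ContDiff Topology Bundle

noncomputable section

namespace Helicoidal

variable {n : ℕ} {M : Type*} [TopologicalSpace M] [ChartedSpace (EuclideanSpace ℝ (Fin n)) M]

section Submanifold

/-- A local parametrization of the subset `S ⊆ M` as a twice differentiable embedded
`m`-dimensional submanifold: a twice differentiable immersion of an open subset `domain` of `ℝᵐ`
that is a homeomorphism onto a relatively open subset of `S`. -/
structure LocalParametrization (S : Set M) (m : ℕ) where
  /-- the open set of parameters -/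
  domain : Set (EuclideanSpace ℝ (Fin m))
  /-- the parametrization; only its values on `domain` matter -/
  toFun : EuclideanSpace ℝ (Fin m) → M
  isOpen_domain : IsOpen domain
  mdifferentiableOn : MDifferentiableOn (𝓡 m) (𝓡 n) toFun domain
  /-- in local coordinates the first derivative is differentiable at every point of `domain` -/
  differentiableAt_fderiv : ∀ x ∈ domain,
    DifferentiableAt ℝ (fderiv ℝ (extChartAt (𝓡 n) (toFun x) ∘ toFun)) x
  injective_mfderiv : ∀ x ∈ domain, Function.Injective (mfderiv (𝓡 m) (𝓡 n) toFun x)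
  isEmbedding : Topology.IsEmbedding (domain.domRestrict toFun)
  image_eq : ∃ W : Set M, IsOpen W ∧ toFun '' domain = S ∩ W

/-- The tangent space at `f x` of the submanifold parametrized by `f`, namely the image of
`df_x`. -/
def tangentSubspace {m : ℕ} (f : EuclideanSpace ℝ (Fin m) → M) (x : EuclideanSpace ℝ (Fin m)) :
    Submodule ℝ (TangentSpace (𝓡 n) (f x)) :=
  (mfderiv (𝓡 m) (𝓡 n) f x).range

/-- The regular part of `S`: the points of `S` near which `S` is a twice differentiable embedded
`m`-dimensional submanifold of `M`. -/
def regularPart (S : Set M) (m : ℕ) : Set M :=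
  {p | ∃ P : LocalParametrization (n := n) S m, ∃ x ∈ P.domain, P.toFun x = p}

end Submanifold

variable [IsManifold (𝓡 n) ∞ M] [Bundle.RiemannianBundle (fun p : M ↦ TangentSpace (𝓡 n) p)]

section LeviCivita

/-- The matrix `g_{ij}` of the Riemannian metric in the preferred chart at `p`, at the point with
coordinates `y`. -/
def chartMetric (p : M) (y : EuclideanSpace ℝ (Fin n)) : Matrix (Fin n) (Fin n) ℝ :=
  Matrix.of fun i j ↦ inner ℝ
    (mfderiv (𝓡 n) (𝓡 n) (extChartAt (𝓡 n) p).symm y (EuclideanSpace.single i (1 : ℝ)))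
    (mfderiv (𝓡 n) (𝓡 n) (extChartAt (𝓡 n) p).symm y (EuclideanSpace.single j (1 : ℝ)))

/-- The partial derivative `∂_k g_{ij}` in the preferred chart at `p`. -/
def chartMetricDeriv (p : M) (y : EuclideanSpace ℝ (Fin n)) (k i j : Fin n) : ℝ :=
  fderiv ℝ (fun z ↦ chartMetric p z i j) y (EuclideanSpace.single k (1 : ℝ))

/-- The Christoffel symbol
`Γᵏᵢⱼ = ½ ∑ₗ gᵏˡ (∂ᵢ gⱼₗ + ∂ⱼ gᵢₗ - ∂ₗ gᵢⱼ)` of the Levi-Civita connection in the preferred chart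
at `p`. -/
def christoffelSymbol (p : M) (y : EuclideanSpace ℝ (Fin n)) (k i j : Fin n) : ℝ :=
  (1 / 2 : ℝ) * ∑ l, (chartMetric p y)⁻¹ k l *
    (chartMetricDeriv p y i j l + chartMetricDeriv p y j i l - chartMetricDeriv p y l i j)

/-- The Christoffel symbols as the bilinear expression `(∑ᵢⱼ Γᵏᵢⱼ uⁱ vʲ)ₖ`. -/
def christoffel (p : M) (y u v : EuclideanSpace ℝ (Fin n)) : EuclideanSpace ℝ (Fin n) :=
  WithLp.toLp 2 fun k ↦ ∑ i, ∑ j, christoffelSymbol p y k i j * u i * v j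

/-- The Levi-Civita covariant derivative `∇_a Y` at the parameter `x` of a vector field `Y` along a
map `f : ℝᵐ → M`. In the preferred chart at `f x` it is `∂_a Y + Γ(df a, Y)`; the inverse of the
differential of the chart turns this coordinate vector into a tangent vector at `f x`. -/
def covariantDerivAlong {m : ℕ} (f : EuclideanSpace ℝ (Fin m) → M)
    (Y : ∀ z, TangentSpace (𝓡 n) (f z)) (x a : EuclideanSpace ℝ (Fin m)) :
    TangentSpace (𝓡 n) (f x) :=
  let ψ := extChartAt (𝓡 n) (f x)
  let Ycoord : EuclideanSpace ℝ (Fin m) → EuclideanSpace ℝ (Fin n) :=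
    fun z ↦ mfderiv (𝓡 n) (𝓡 n) ψ (f z) (Y z)
  (mfderiv (𝓡 n) (𝓡 n) ψ (f x)).inverse
    (fderiv ℝ Ycoord x a + christoffel (f x) (ψ (f x)) (fderiv ℝ (ψ ∘ f) x a) (Ycoord x))

end LeviCivita

section MeanCurvature

instance (p : M) : FiniteDimensional ℝ (TangentSpace (𝓡 n) p) :=
  inferInstanceAs (FiniteDimensional ℝ (EuclideanSpace ℝ (Fin n)))

/-- The second fundamental form `(∇_a (df b))^⊥` of the immersion `f` at `x`, evaluated on
`df_x a` and `df_x b`. -/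
def secondFundamentalForm {m : ℕ} (f : EuclideanSpace ℝ (Fin m) → M)
    (x a b : EuclideanSpace ℝ (Fin m)) : TangentSpace (𝓡 n) (f x) :=
  (tangentSubspace (n := n) f x)ᗮ.starProjection
    (covariantDerivAlong (n := n) f (fun z ↦ mfderiv (𝓡 m) (𝓡 n) f z b) x a)

/-- The matrix `h_{ij} = ⟨∂ᵢ f, ∂ⱼ f⟩` of the metric induced by `f`. -/
def inducedMetric {m : ℕ} (f : EuclideanSpace ℝ (Fin m) → M) (x : EuclideanSpace ℝ (Fin m)) :
    Matrix (Fin m) (Fin m) ℝ :=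
  Matrix.of fun i j ↦ inner ℝ
    (mfderiv (𝓡 m) (𝓡 n) f x (EuclideanSpace.single i (1 : ℝ)))
    (mfderiv (𝓡 m) (𝓡 n) f x (EuclideanSpace.single j (1 : ℝ)))

/-- The mean curvature vector at `f x`: the trace `∑ᵢⱼ hⁱʲ II(∂ᵢ f, ∂ⱼ f)` of the second
fundamental form with respect to the induced metric. It equals `∑ᵢ (∇_{eᵢ} eᵢ)^⊥` for every local
orthonormal tangent frame `eᵢ`. -/
def meanCurvatureVector {m : ℕ} (f : EuclideanSpace ℝ (Fin m) → M)
    (x : EuclideanSpace ℝ (Fin m)) : TangentSpace (𝓡 n) (f x) :=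
  ∑ i, ∑ j, (inducedMetric (n := n) f x)⁻¹ i j •
    secondFundamentalForm (n := n) f x (EuclideanSpace.single i 1) (EuclideanSpace.single j 1)

end MeanCurvature

/-- A diffeomorphism of `M` is an isometry if its differential preserves the Riemannian metric. -/
def IsRiemannianIsometry (φ : M ≃ₘ⟮𝓡 n, 𝓡 n⟯ M) : Prop :=
  ∀ (p : M) (v w : TangentSpace (𝓡 n) p),
    inner ℝ (mfderiv (𝓡 n) (𝓡 n) φ p v) (mfderiv (𝓡 n) (𝓡 n) φ p w) = inner ℝ v w

/-- `S` is helicoidal (as an `m`-dimensional subset of `M`): for each `p ∈ S` some isometry `φ` of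
`M` fixes `p`, maps `S` onto itself and satisfies `φ_* v = -v` for each `v` normal at `p` to the
regular part of `S`. The last condition concerns only regular points `p`, since there is
no tangent space at the others. The regular part is not required to have full measure in `S`. -/
def IsHelicoidal (S : Set M) (m : ℕ) : Prop :=
  ∀ p ∈ S, ∃ φ : M ≃ₘ⟮𝓡 n, 𝓡 n⟯ M, IsRiemannianIsometry φ ∧ φ p = p ∧ φ '' S = S ∧
    ∀ (P : LocalParametrization (n := n) S m), ∀ x ∈ P.domain, P.toFun x = p →
      ∀ v ∈ (tangentSubspace (n := n) P.toFun x)ᗮ,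
        tangentMap (𝓡 n) (𝓡 n) φ ⟨P.toFun x, v⟩ = ⟨P.toFun x, -v⟩

/-- `S` is minimal at `p`: the mean curvature vector of `S` at `p` vanishes (computed in any local
parametrization of `S` near `p`). -/
def IsMinimalAt (S : Set M) (m : ℕ) (p : M) : Prop :=
  ∀ (P : LocalParametrization (n := n) S m), ∀ x ∈ P.domain, P.toFun x = p →
    meanCurvatureVector (n := n) P.toFun x = 0

end Helicoidal

end

/-! Let `φ` be an isometry that fixes `p = P x`, preserves `S` and reverses the normal space at `p`.
Locally `φ ∘ P = P ∘ θ` for a map `θ` of the parameter domain that fixes `x`, and the differential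
`A` of `θ` at `x` is orthogonal for the induced metric. For a normal vector `w` consider the Hessian
`β_w(u, v) = ⟨∇_u dP(v), w⟩`. Since `φ` preserves the Levi-Civita connection and `φ_* w = -w`,
passing from `P` to `φ ∘ P` turns `β_w` into `β_{-w} = -β_w`; on the other hand passing from `P` to
`P ∘ θ` turns it into `β_w(A u, A v)`, the second derivatives of `θ` contributing only tangential
terms. Hence `β_w(A u, A u) = -β_w(u, u)`, and as the trace with respect to the induced metric is
invariant under `A`, the trace `⟨H, w⟩` of `β_w` is zero. Take `w = H`.

The map `θ` is only known to be once differentiable, being obtained by inverting the embedding `P`.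
Its second derivative is never formed: the function `⟨P, w⟩` in a chart is critical at `x`, so that
its second order Taylor expansion along `θ (x + t u)` involves only the first derivative of `θ`. -/

noncomputable section

namespace Helicoidal

section TwiceDifferentiable

variable {V W X : Type*} [NormedAddCommGroup V] [NormedSpace ℝ V] [NormedAddCommGroup W]
  [NormedSpace ℝ W] [NormedAddCommGroup X] [NormedSpace ℝ X]

/-- Twice differentiability at a point, without continuity of the second derivative. This is the
regularity of the submanifolds considered here, weaker than `ContDiffAt ℝ 2`. -/
structure TwiceDifferentiableAt (f : V → W) (x : V) : Prop where
  eventually_differentiableAt : ∀ᶠ z in 𝓝 x, DifferentiableAt ℝ f z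
  differentiableAt_fderiv : DifferentiableAt ℝ (fderiv ℝ f) x

namespace TwiceDifferentiableAt

variable {f : V → W} {g : W → X} {x : V}

lemma of_contDiffAt (hf : ContDiffAt ℝ 2 f x) :
    TwiceDifferentiableAt f x where
  eventually_differentiableAt :=
    (hf.eventually (by simp)).mono fun _ hz ↦ hz.differentiableAt (by simp)
  differentiableAt_fderiv :=
    (hf.fderiv_right (m := 1) (by norm_num)).differentiableAt (by simp)

lemma differentiableAt (hf : TwiceDifferentiableAt f x) : DifferentiableAt ℝ f x :=
  hf.eventually_differentiableAt.self_of_nhds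

lemma fderiv_fderiv_comm (hf : TwiceDifferentiableAt f x) (a b : V) :
    fderiv ℝ (fderiv ℝ f) x a b = fderiv ℝ (fderiv ℝ f) x b a :=
  second_derivative_symmetric_of_eventually
    (hf.eventually_differentiableAt.mono fun _ hz ↦ hz.hasFDerivAt)
    hf.differentiableAt_fderiv.hasFDerivAt a b

lemma eventually_fderiv_comp (hg : TwiceDifferentiableAt g (f x))
    (hf : TwiceDifferentiableAt f x) :
    ∀ᶠ z in 𝓝 x, HasFDerivAt (g ∘ f) ((fderiv ℝ g (f z)).comp (fderiv ℝ f z)) z := by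
  filter_upwards [hf.eventually_differentiableAt,
    hf.differentiableAt.continuousAt.eventually hg.eventually_differentiableAt] with z hfz hgz
  exact hgz.hasFDerivAt.comp z hfz.hasFDerivAt

lemma hasFDerivAt_fderiv_comp (hg : TwiceDifferentiableAt g (f x))
    (hf : TwiceDifferentiableAt f x) :
    HasFDerivAt (fderiv ℝ (g ∘ f))
      (((ContinuousLinearMap.compL ℝ V W X (fderiv ℝ g (f x))).comp (fderiv ℝ (fderiv ℝ f) x)) +
      ((ContinuousLinearMap.compL ℝ V W X).flip (fderiv ℝ f x)).comp
        ((fderiv ℝ (fderiv ℝ g) (f x)).comp (fderiv ℝ f x))) x :=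
  ((hg.differentiableAt_fderiv.hasFDerivAt.comp x hf.differentiableAt.hasFDerivAt).clm_comp
    hf.differentiableAt_fderiv.hasFDerivAt).congr_of_eventuallyEq
      ((eventually_fderiv_comp hg hf).mono fun _ hz ↦ hz.fderiv)

lemma comp (hg : TwiceDifferentiableAt g (f x)) (hf : TwiceDifferentiableAt f x) :
    TwiceDifferentiableAt (g ∘ f) x where
  eventually_differentiableAt :=
    (eventually_fderiv_comp hg hf).mono fun _ hz ↦ hz.differentiableAt
  differentiableAt_fderiv := (hasFDerivAt_fderiv_comp hg hf).differentiableAt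

lemma fderiv_fderiv_comp (hg : TwiceDifferentiableAt g (f x)) (hf : TwiceDifferentiableAt f x)
    (a b : V) : fderiv ℝ (fderiv ℝ (g ∘ f)) x a b =
      fderiv ℝ (fderiv ℝ g) (f x) (fderiv ℝ f x a) (fderiv ℝ f x b) +
        fderiv ℝ g (f x) (fderiv ℝ (fderiv ℝ f) x a b) := by
  rw [(hasFDerivAt_fderiv_comp hg hf).fderiv, add_comm]
  rfl

lemma clm_comp (ν : W →L[ℝ] X) (hf : TwiceDifferentiableAt f x) :
    TwiceDifferentiableAt (ν ∘ f) x :=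
  (of_contDiffAt ν.contDiff.contDiffAt).comp hf

lemma fderiv_fderiv_clm_comp (ν : W →L[ℝ] X) (hf : TwiceDifferentiableAt f x) (a b : V) :
    fderiv ℝ (fderiv ℝ (ν ∘ f)) x a b = ν (fderiv ℝ (fderiv ℝ f) x a b) := by
  have hν : fderiv ℝ (ν : W → X) = fun _ ↦ ν := funext fun _ ↦ ν.fderiv
  rw [fderiv_fderiv_comp (of_contDiffAt ν.contDiff.contDiffAt) hf]
  simp [hν]

lemma isLittleO_taylor (hf : TwiceDifferentiableAt f x) :
    (fun z ↦ f z - f x - fderiv ℝ f x (z - x) -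
      (1 / 2 : ℝ) • fderiv ℝ (fderiv ℝ f) x (z - x) (z - x)) =o[𝓝 x] fun z ↦ ‖z - x‖ ^ 2 := by
  set f' := fderiv ℝ f
  set f'' := fderiv ℝ f' x
  rw [Asymptotics.isLittleO_iff]
  intro ε hε
  obtain ⟨δ, hδ, hball⟩ := Metric.eventually_nhds_iff_ball.1 (hf.eventually_differentiableAt.and
    (Asymptotics.isLittleO_iff.1 hf.differentiableAt_fderiv.hasFDerivAt.isLittleO hε))
  filter_upwards [Metric.ball_mem_nhds x hδ] with z hz
  let R : V → W := fun y ↦ f y - f' x (y - x) - (1 / 2 : ℝ) • f'' (y - x) (y - x)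
  have hR : ∀ y ∈ Metric.ball x δ, HasFDerivAt R (f' y - f' x - f'' (y - x)) y := by
    intro y hy
    have hsub : HasFDerivAt (fun z ↦ z - x) (ContinuousLinearMap.id ℝ V) y :=
      (hasFDerivAt_id y).sub_const x
    refine (((hball y hy).1.hasFDerivAt.sub ((f' x).hasFDerivAt.comp y hsub)).sub
      (((f''.hasFDerivAt.comp y hsub).clm_apply hsub).const_smul (1 / 2 : ℝ))).congr_fderiv ?_
    ext v
    have hcomm : f'' v (y - x) = f'' (y - x) v := hf.fderiv_fderiv_comm v (y - x)
    simp only [ContinuousLinearMap.comp_id, sub_apply, add_apply, smul_apply,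
      ContinuousLinearMap.flip_apply, Function.comp_apply, hcomm]
    module
  have hsegment : segment ℝ x z ⊆ Metric.ball x δ ∩ Metric.closedBall x ‖z - x‖ :=
    ((convex_ball x δ).inter (convex_closedBall x _)).segment_subset
      ⟨Metric.mem_ball_self hδ, Metric.mem_closedBall_self (norm_nonneg _)⟩
      ⟨hz, by simp [dist_eq_norm]⟩
  have hmean : ‖R z - R x‖ ≤ ε * ‖z - x‖ * ‖z - x‖ := by
    refine (convex_segment x z).norm_image_sub_le_of_norm_hasFDerivWithin_le
      (fun y hy ↦ (hR y (hsegment hy).1).hasFDerivWithinAt) (fun y hy ↦ ?_)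
      (left_mem_segment ℝ x z) (right_mem_segment ℝ x z)
    refine (hball y (hsegment hy).1).2.trans ?_
    gcongr
    simpa [dist_eq_norm] using (hsegment hy).2
  have hRz : R z - R x = f z - f x - f' x (z - x) - (1 / 2 : ℝ) • f'' (z - x) (z - x) := by
    simp only [R, sub_self, map_zero, smul_zero, sub_zero]
    abel
  rw [← hRz]
  simpa [pow_two, mul_assoc] using hmean

lemma tendsto_of_fderiv_eq_zero (hf : TwiceDifferentiableAt f x) (h0 : fderiv ℝ f x = 0)
    {c : ℝ → V} {v : V} (hc : HasDerivAt c v 0) (hc0 : c 0 = x) :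
    Filter.Tendsto (fun t ↦ (t ^ 2)⁻¹ • (f (c t) - f x)) (𝓝[≠] 0)
      (𝓝 ((1 / 2 : ℝ) • fderiv ℝ (fderiv ℝ f) x v v)) := by
  subst hc0
  have hslope : Filter.Tendsto (fun t ↦ t⁻¹ • (c t - c 0)) (𝓝[≠] 0) (𝓝 v) := by
    simpa using hc.tendsto_slope_zero
  have hquad : Filter.Tendsto (fun t ↦ (1 / 2 : ℝ) • fderiv ℝ (fderiv ℝ f) (c 0)
      (t⁻¹ • (c t - c 0)) (t⁻¹ • (c t - c 0))) (𝓝[≠] 0)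
      (𝓝 ((1 / 2 : ℝ) • fderiv ℝ (fderiv ℝ f) (c 0) v v)) :=
    ((by fun_prop : Continuous fun w ↦
      (1 / 2 : ℝ) • fderiv ℝ (fderiv ℝ f) (c 0) w w).tendsto v).comp hslope
  have hO : (fun t ↦ ‖c t - c 0‖ ^ 2) =O[𝓝[≠] 0] fun t : ℝ ↦ t ^ 2 := by
    simpa using (hc.isBigO_sub.norm_left.pow 2).mono nhdsWithin_le_nhds
  have hrem := (hf.isLittleO_taylor.comp_tendsto
    (hc.continuousAt.tendsto.mono_left nhdsWithin_le_nhds)).trans_isBigO hO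
  have hsum := hrem.tendsto_inv_smul_nhds_zero.add hquad
  rw [zero_add] at hsum
  refine hsum.congr fun t ↦ ?_
  simp only [Function.comp_apply, h0, zero_apply, sub_zero, map_smul, smul_apply]
  module

end TwiceDifferentiableAt

lemma fderiv_fderiv_of_comp_eq {f : W → X} {g : V → X} {θ : V → W} {A : V →L[ℝ] W} {x : V}
    (hf : TwiceDifferentiableAt f (θ x)) (h0 : fderiv ℝ f (θ x) = 0)
    (hg : TwiceDifferentiableAt g x) (hθ : HasFDerivAt θ A x) (hfg : f ∘ θ =ᶠ[𝓝 x] g) (v : V) :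
    fderiv ℝ (fderiv ℝ g) x v v = fderiv ℝ (fderiv ℝ f) (θ x) (A v) (A v) := by
  have hg0 : fderiv ℝ g x = 0 := by
    rw [← hfg.fderiv_eq, fderiv_comp x hf.differentiableAt hθ.differentiableAt, h0,
      ContinuousLinearMap.zero_comp]
  have hline : HasDerivAt (fun t : ℝ ↦ x + t • v) v 0 := by
    simpa using ((hasDerivAt_id (0 : ℝ)).smul_const v).const_add x
  have hline0 : x + (0 : ℝ) • v = x := by simp
  have hcurve : HasDerivAt (fun t : ℝ ↦ θ (x + t • v)) (A v) 0 :=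
    HasFDerivAt.comp_hasDerivAt (0 : ℝ) (by rwa [hline0]) hline
  have hfg' : ∀ᶠ t in 𝓝[≠] (0 : ℝ), f (θ (x + t • v)) = g (x + t • v) := by
    have ht := hline.continuousAt.tendsto
    rw [hline0] at ht
    exact (ht.eventually hfg).filter_mono nhdsWithin_le_nhds
  have hlim := hg.tendsto_of_fderiv_eq_zero hg0 hline hline0
  have hlim' := hf.tendsto_of_fderiv_eq_zero h0 hcurve (by rw [hline0])
  refine smul_right_injective X (by norm_num : (1 / 2 : ℝ) ≠ 0)
    (tendsto_nhds_unique hlim (hlim'.congr' ?_))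
  filter_upwards [hfg'] with t ht
  rw [ht, show f (θ x) = g x from hfg.self_of_nhds]

lemma hasFDerivAt_of_comp_of_leftInverse {F : W → X} {F' : W →L[ℝ] X} {L : X →L[ℝ] W}
    {H' : V →L[ℝ] X} {θ : V → W} {x : V} (hF : HasFDerivAt F F' (θ x))
    (hL : L.comp F' = ContinuousLinearMap.id ℝ W) (hFθ : HasFDerivAt (F ∘ θ) H' x)
    (hθ : ContinuousAt θ x) : HasFDerivAt θ (L.comp H') x := by
  have hequiv : Asymptotics.IsEquivalent (𝓝 x) (fun z ↦ L (F (θ z) - F (θ x)))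
      (fun z ↦ θ z - θ x) := by
    refine ((L.isBigO_comp _ _).trans_isLittleO (hF.isLittleO.comp_tendsto hθ)).congr_left
      fun z ↦ ?_
    simpa using DFunLike.congr_fun hL (θ z - θ x)
  have hLFθ : HasFDerivAt (L ∘ F ∘ θ) (L.comp H') x := L.hasFDerivAt.comp x hFθ
  have hO : (fun z ↦ L (F (θ z) - F (θ x))) =O[𝓝 x] fun z ↦ z - x := by
    simpa using hLFθ.isBigO_sub
  refine HasFDerivAt.of_isLittleO
    ((hLFθ.isLittleO.sub (hequiv.symm.isLittleO.trans_isBigO hO |>.neg_left)).congr_left fun z ↦ ?_)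
  simp only [Function.comp_apply, map_sub, Pi.sub_apply]
  abel

end TwiceDifferentiable

section MetricCalculus

variable {V W : Type*} [NormedAddCommGroup V] [NormedSpace ℝ V] [NormedAddCommGroup W]
  [NormedSpace ℝ W]

/-- The Christoffel symbols of the first kind `w ↦ ½ (∂_u g(v, w) + ∂_v g(u, w) - ∂_w g(u, v))` of a
metric `g` on a normed space. By the Koszul formula this is `w ↦ g(Γ(u, v), w)`. -/
def christoffelFirstKind (g : W → W →L[ℝ] W →L[ℝ] ℝ) (y : W) : W →ₗ[ℝ] W →ₗ[ℝ] W →L[ℝ] ℝ :=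
  LinearMap.mk₂ ℝ
    (fun u v ↦ (1 / 2 : ℝ) •
      (fderiv ℝ g y u v + fderiv ℝ g y v u - ((fderiv ℝ g y).flip u).flip v))
    (fun _ _ _ ↦ by
      simp only [ContinuousLinearMap.map_add, add_apply, ContinuousLinearMap.flip_add]
      module)
    (fun _ _ _ ↦ by
      simp only [ContinuousLinearMap.map_smul, smul_apply, ContinuousLinearMap.flip_smul]
      module)
    (fun _ _ _ ↦ by
      simp only [ContinuousLinearMap.map_add, add_apply]
      module)
    (fun _ _ _ ↦ by
      simp only [ContinuousLinearMap.map_smul, smul_apply]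
      module)

lemma christoffelFirstKind_apply (g : W → W →L[ℝ] W →L[ℝ] ℝ) (y u v w : W) :
    christoffelFirstKind g y u v w =
      (1 / 2 : ℝ) * (fderiv ℝ g y u v w + fderiv ℝ g y v u w - fderiv ℝ g y w u v) := rfl

/-- The covariant Hessian `⟨∇_a (dF b), w⟩` of a map `F` at `x`, tested against a vector `w` at
`F x`, for the Levi-Civita connection `∇` of the metric `g` on the target. -/
def covariantHessian (g : W → W →L[ℝ] W →L[ℝ] ℝ) (F : V → W) (x : V) (w : W) :
    LinearMap.BilinForm ℝ V :=
  LinearMap.mk₂ ℝ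
    (fun a b ↦ g (F x) w (fderiv ℝ (fderiv ℝ F) x a b) +
      christoffelFirstKind g (F x) (fderiv ℝ F x a) (fderiv ℝ F x b) w)
    (fun _ _ _ ↦ by simp only [map_add, add_apply, LinearMap.add_apply]; ring)
    (fun _ _ _ ↦ by simp only [map_smul, smul_apply, LinearMap.smul_apply, smul_add])
    (fun _ _ _ ↦ by simp only [map_add, add_apply]; ring)
    (fun _ _ _ ↦ by simp only [map_smul, smul_apply, smul_add])

lemma covariantHessian_apply (g : W → W →L[ℝ] W →L[ℝ] ℝ) (F : V → W) (x : V) (w : W) (a b : V) :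
    covariantHessian g F x w a b = g (F x) w (fderiv ℝ (fderiv ℝ F) x a b) +
      christoffelFirstKind g (F x) (fderiv ℝ F x a) (fderiv ℝ F x b) w := rfl

lemma covariantHessian_smul (g : W → W →L[ℝ] W →L[ℝ] ℝ) (F : V → W) (x : V) (c : ℝ) (w : W)
    (a b : V) : covariantHessian g F x (c • w) a b = c * covariantHessian g F x w a b := by
  simp only [covariantHessian_apply, christoffelFirstKind_apply, ContinuousLinearMap.map_smul,
    smul_apply, smul_eq_mul]
  ring

/-- Near `y` the map `Φ` pulls the metric `h` back to the metric `g`. A metric is encoded as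
a field of bilinear forms, not necessarily symmetric or positive definite. -/
def IsLocalIsometryAt (g : V → V →L[ℝ] V →L[ℝ] ℝ) (h : W → W →L[ℝ] W →L[ℝ] ℝ) (Φ : V → W)
    (y : V) : Prop :=
  ∀ᶠ z in 𝓝 y, ∀ u v, h (Φ z) (fderiv ℝ Φ z u) (fderiv ℝ Φ z v) = g z u v

namespace IsLocalIsometryAt

variable {U : Type*} [NormedAddCommGroup U] [NormedSpace ℝ U]
  {g : V → V →L[ℝ] V →L[ℝ] ℝ} {h : W → W →L[ℝ] W →L[ℝ] ℝ} {Φ : V → W} {y : V}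

lemma fderiv_apply (hΦh : IsLocalIsometryAt g h Φ y) (hΦ : TwiceDifferentiableAt Φ y)
    (hg : DifferentiableAt ℝ g y) (hh : DifferentiableAt ℝ h (Φ y)) (c a b : V) :
    fderiv ℝ g y c a b =
      fderiv ℝ h (Φ y) (fderiv ℝ Φ y c) (fderiv ℝ Φ y a) (fderiv ℝ Φ y b) +
      h (Φ y) (fderiv ℝ (fderiv ℝ Φ) y c a) (fderiv ℝ Φ y b) +
      h (Φ y) (fderiv ℝ Φ y a) (fderiv ℝ (fderiv ℝ Φ) y c b) := by
  have hΦ' (d : V) : HasFDerivAt (fun z ↦ fderiv ℝ Φ z d)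
      ((fderiv ℝ (fderiv ℝ Φ) y).flip d) y := by
    simpa using hΦ.differentiableAt_fderiv.hasFDerivAt.clm_apply (hasFDerivAt_const d y)
  have hgab : HasFDerivAt (fun z ↦ g z a b) (((fderiv ℝ g y).flip a).flip b) y := by
    simpa using (hg.hasFDerivAt.clm_apply (hasFDerivAt_const a y)).clm_apply
      (hasFDerivAt_const b y)
  have hhΦ := HasFDerivAt.comp (g := h) y hh.hasFDerivAt hΦ.differentiableAt.hasFDerivAt
  have hpull := (hhΦ.clm_apply (hΦ' a)).clm_apply (hΦ' b)
  have heq := hgab.unique (hpull.congr_of_eventuallyEq (hΦh.mono fun z hz ↦ (hz a b).symm))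
  have heqc := DFunLike.congr_fun heq c
  simp only [ContinuousLinearMap.flip_apply, Function.comp_apply, ContinuousLinearMap.flip_add,
    add_apply, ContinuousLinearMap.comp_apply] at heqc
  rw [heqc]
  ring

lemma covariantHessian_eq_christoffelFirstKind (hΦh : IsLocalIsometryAt g h Φ y)
    (hΦ : TwiceDifferentiableAt Φ y) (hg : DifferentiableAt ℝ g y)
    (hh : DifferentiableAt ℝ h (Φ y)) (hsymm : ∀ u v, h (Φ y) u v = h (Φ y) v u) (w u v : V) :
    covariantHessian h Φ y (fderiv ℝ Φ y w) u v = christoffelFirstKind g y u v w := by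
  have key := hΦh.fderiv_apply hΦ hg hh
  simp only [covariantHessian_apply, christoffelFirstKind_apply, key,
    hΦ.fderiv_fderiv_comm w, hΦ.fderiv_fderiv_comm v u]
  rw [hsymm (fderiv ℝ (fderiv ℝ Φ) y u v), hsymm (fderiv ℝ (fderiv ℝ Φ) y u w)]
  ring

lemma covariantHessian_comp {F : U → V} {x : U} (hΦh : IsLocalIsometryAt g h Φ (F x))
    (hΦ : TwiceDifferentiableAt Φ (F x)) (hF : TwiceDifferentiableAt F x)
    (hg : DifferentiableAt ℝ g (F x)) (hh : DifferentiableAt ℝ h (Φ (F x)))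
    (hsymm : ∀ u v, h (Φ (F x)) u v = h (Φ (F x)) v u) (w : V) (a b : U) :
    covariantHessian h (Φ ∘ F) x (fderiv ℝ Φ (F x) w) a b = covariantHessian g F x w a b := by
  have hΦF : fderiv ℝ (Φ ∘ F) x = (fderiv ℝ Φ (F x)).comp (fderiv ℝ F x) :=
    fderiv_comp x hΦ.differentiableAt hF.differentiableAt
  have hT := hΦh.covariantHessian_eq_christoffelFirstKind hΦ hg hh hsymm w
    (fderiv ℝ F x a) (fderiv ℝ F x b)
  rw [covariantHessian_apply] at hT
  simp only [covariantHessian_apply, Function.comp_apply, hΦ.fderiv_fderiv_comp hF, hΦF,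
    ContinuousLinearMap.comp_apply, map_add, ← hT, ← hΦh.self_of_nhds w]
  ring

end IsLocalIsometryAt

lemma covariantHessian_of_comp_eq {U : Type*} [NormedAddCommGroup U] [NormedSpace ℝ U]
    {g : W → W →L[ℝ] W →L[ℝ] ℝ} {F : V → W} {H : U → W} {θ : U → V} {A : U →L[ℝ] V} {x : U} {w : W}
    (hF : TwiceDifferentiableAt F (θ x)) (hH : TwiceDifferentiableAt H x)
    (hθ : HasFDerivAt θ A x) (hFH : F ∘ θ =ᶠ[𝓝 x] H)
    (hw : ∀ a, g (F (θ x)) w (fderiv ℝ F (θ x) a) = 0) (u : U) :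
    covariantHessian g H x w u u = covariantHessian g F (θ x) w (A u) (A u) := by
  have hFx : F (θ x) = H x := hFH.self_of_nhds
  have hH' : fderiv ℝ H x = (fderiv ℝ F (θ x)).comp A :=
    hFH.fderiv_eq.symm.trans (hF.differentiableAt.hasFDerivAt.comp x hθ).fderiv
  have hcritical : fderiv ℝ (g (F (θ x)) w ∘ F) (θ x) = 0 := by
    rw [fderiv_comp _ (g (F (θ x)) w).differentiableAt hF.differentiableAt,
      ContinuousLinearMap.fderiv]
    exact ContinuousLinearMap.ext hw
  have hsecond := fderiv_fderiv_of_comp_eq (hF.clm_comp (g (F (θ x)) w)) hcritical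
    (hH.clm_comp (g (F (θ x)) w)) hθ (hFH.fun_comp (g (F (θ x)) w)) u
  rw [hH.fderiv_fderiv_clm_comp, hF.fderiv_fderiv_clm_comp, hFx] at hsecond
  simp only [covariantHessian_apply, hH', ContinuousLinearMap.comp_apply, hsecond, hFx]

lemma IsLocalIsometryAt.apply_fderiv_of_semiconj {g : W → W →L[ℝ] W →L[ℝ] ℝ} {Φ : W → W}
    {F : V → W} {θ : V → V} {A : V →L[ℝ] V} {x : V} (hΦg : IsLocalIsometryAt g g Φ (F x))
    (hΦ : DifferentiableAt ℝ Φ (F x)) (hF : DifferentiableAt ℝ F x) (hΦx : Φ (F x) = F x)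
    (hθ : HasFDerivAt θ A x) (hθx : θ x = x) (hFθ : F ∘ θ =ᶠ[𝓝 x] Φ ∘ F) (u v : V) :
    g (F x) (fderiv ℝ F x (A u)) (fderiv ℝ F x (A v)) =
      g (F x) (fderiv ℝ F x u) (fderiv ℝ F x v) := by
  have hFA : (fderiv ℝ F x).comp A = (fderiv ℝ Φ (F x)).comp (fderiv ℝ F x) := by
    have hFθ' : HasFDerivAt (F ∘ θ) ((fderiv ℝ F x).comp A) x :=
      HasFDerivAt.comp x (by rw [hθx]; exact hF.hasFDerivAt) hθ
    exact hFθ'.unique ((hΦ.hasFDerivAt.comp x hF.hasFDerivAt).congr_of_eventuallyEq hFθ)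
  have hFA_apply (a : V) : fderiv ℝ F x (A a) = fderiv ℝ Φ (F x) (fderiv ℝ F x a) :=
    DFunLike.congr_fun hFA a
  rw [hFA_apply, hFA_apply, ← hΦg.self_of_nhds (fderiv ℝ F x u), hΦx]

/-- Only the quadratic form of the Hessian is compared, and only in a normal direction, because
`θ` need not be twice differentiable. -/
lemma covariantHessian_neg_of_isometry {g : W → W →L[ℝ] W →L[ℝ] ℝ} {Φ : W → W} {F : V → W}
    {θ : V → V} {A : V →L[ℝ] V} {x : V} {w : W}
    (hΦg : IsLocalIsometryAt g g Φ (F x)) (hΦ : TwiceDifferentiableAt Φ (F x))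
    (hF : TwiceDifferentiableAt F x) (hg : DifferentiableAt ℝ g (F x))
    (hsymm : ∀ u v, g (F x) u v = g (F x) v u) (hΦx : Φ (F x) = F x)
    (hΦw : fderiv ℝ Φ (F x) w = -w) (hw : ∀ a, g (F x) w (fderiv ℝ F x a) = 0)
    (hθ : HasFDerivAt θ A x) (hθx : θ x = x) (hFθ : F ∘ θ =ᶠ[𝓝 x] Φ ∘ F) (u : V) :
    covariantHessian g F x w (A u) (A u) = -covariantHessian g F x w u u := by
  have hnaturality := hΦg.covariantHessian_comp hΦ hF hg (by rwa [hΦx]) (by rwa [hΦx]) w u u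
  have hreparam : covariantHessian g (Φ ∘ F) x w u u =
      covariantHessian g F (θ x) w (A u) (A u) :=
    covariantHessian_of_comp_eq (by rwa [hθx]) (hΦ.comp hF) hθ hFθ (by rwa [hθx]) u
  rw [hθx] at hreparam
  rw [← hreparam, ← hnaturality, hΦw, ← neg_one_smul ℝ w, covariantHessian_smul, neg_one_mul,
    neg_neg]

end MetricCalculus

section Trace

open Matrix LinearMap.BilinForm

variable {R ι : Type*} [Fintype ι]

lemma trace_mul_eq_zero_of_isSymm_of_isSkew [CommRing R] [NoZeroDivisors R] [NeZero (2 : R)]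
    {K S : Matrix ι ι R} (hK : K.IsSymm) (hS : Sᵀ = -S) : trace (K * S) = 0 := by
  have hneg : trace (K * S) = -trace (K * S) := by
    conv_lhs =>
      rw [← trace_transpose, transpose_mul, hK.eq, hS, trace_mul_comm, mul_neg, trace_neg]
  have htwo : 2 * trace (K * S) = 0 := by rw [two_mul, ← eq_neg_iff_add_eq_zero, ← hneg]
  exact (mul_eq_zero.1 htwo).resolve_left two_ne_zero

lemma conj_inv_eq_inv_of_isometry [CommRing R] [DecidableEq ι] {K A : Matrix ι ι R}
    (hK : IsUnit K.det) (hA : Aᵀ * K * A = K) : A * K⁻¹ * Aᵀ = K⁻¹ := by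
  have hinv : A * (K⁻¹ * Aᵀ * K) = 1 := mul_eq_one_comm.1 <| by
    rw [Matrix.mul_assoc, Matrix.mul_assoc, ← Matrix.mul_assoc Aᵀ, hA, nonsing_inv_mul _ hK]
  calc A * K⁻¹ * Aᵀ = A * (K⁻¹ * Aᵀ * K) * K⁻¹ := by
        simp only [Matrix.mul_assoc, mul_nonsing_inv _ hK, Matrix.mul_one]
    _ = K⁻¹ := by rw [hinv, Matrix.one_mul]

lemma trace_inv_toMatrix_mul_toMatrix_eq_zero {V : Type*} [Field R] [NeZero (2 : R)]
    [AddCommGroup V] [Module R V] [DecidableEq ι] (b : Module.Basis ι R V)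
    {g β : LinearMap.BilinForm R V} {A : V →ₗ[R] V} (hsymm : g.IsSymm) (hg : g.Nondegenerate)
    (hA : ∀ u v, g (A u) (A v) = g u v) (hβ : ∀ v, β (A v) (A v) = -β v v) :
    trace ((toMatrix b g)⁻¹ * toMatrix b β) = 0 := by
  set K := toMatrix b g
  set Q := toMatrix b β
  set T := LinearMap.toMatrix b b A
  have hK : IsUnit K.det := ((nondegenerate_iff_det_ne_zero b).1 hg).isUnit
  have hKT : Tᵀ * K * T = K := by
    rw [← toMatrix_comp, show g.comp A A = g from LinearMap.ext₂ hA]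
  have hsum : toMatrix b (β.comp A A + β) = Tᵀ * Q * T + Q := by
    rw [map_add, toMatrix_comp b b]
  have halt : (β.comp A A + β).IsAlt := fun v ↦ by simp [hβ]
  have hskew : (Tᵀ * Q * T + Q)ᵀ = -(Tᵀ * Q * T + Q) := by
    rw [← hsum]
    ext i j
    simp only [transpose_apply, toMatrix_apply, Matrix.neg_apply, halt.neg_eq]
  have htrace : trace (K⁻¹ * (Tᵀ * Q * T)) = trace (K⁻¹ * Q) := by
    rw [← Matrix.mul_assoc, trace_mul_comm, ← Matrix.mul_assoc, ← Matrix.mul_assoc,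
      conj_inv_eq_inv_of_isometry hK hKT]
  have hzero : trace (K⁻¹ * (Tᵀ * Q * T + Q)) = 0 :=
    trace_mul_eq_zero_of_isSymm_of_isSkew
      (((isSymm_toMatrix_iff_isSymm b).2 hsymm).inv) hskew
  rw [Matrix.mul_add, trace_add, htrace, ← two_mul] at hzero
  exact (mul_eq_zero.1 hzero).resolve_left two_ne_zero

end Trace

section InnerPullback

variable {V E : Type*} [AddCommGroup V] [Module ℝ V] [NormedAddCommGroup E] [InnerProductSpace ℝ E]

/-- The pullback of the inner product under a linear map; for the differential of an immersion this
is the induced metric. -/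
def innerPullback (L : V →ₗ[ℝ] E) : LinearMap.BilinForm ℝ V := (innerₗ E).compl₁₂ L L

@[simp]
lemma innerPullback_apply (L : V →ₗ[ℝ] E) (u v : V) :
    innerPullback L u v = inner ℝ (L u) (L v) := rfl

lemma isSymm_innerPullback (L : V →ₗ[ℝ] E) : (innerPullback L).IsSymm :=
  ⟨fun _ _ ↦ real_inner_comm _ _⟩

lemma nondegenerate_innerPullback {L : V →ₗ[ℝ] E} (hL : Function.Injective L) :
    (innerPullback L).Nondegenerate := by
  refine (LinearMap.IsRefl.nondegenerate_iff_separatingLeft (isSymm_innerPullback L).isRefl).2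
    fun u hu ↦ ?_
  exact hL ((inner_self_eq_zero.1 (hu u)).trans L.map_zero.symm)

end InnerPullback

section ChartDerivative

variable {n m : ℕ} {M : Type*} [TopologicalSpace M] [ChartedSpace (EuclideanSpace ℝ (Fin n)) M]

/-- The differential at `q` of the preferred chart at `p`, with values in `ℝⁿ` rather than in the
tangent spaces of `ℝⁿ`, so that the values at different `q` can be compared. -/
def chartDeriv (p q : M) : TangentSpace (𝓡 n) q →L[ℝ] EuclideanSpace ℝ (Fin n) :=
  mfderiv (𝓡 n) (𝓡 n) (extChartAt (𝓡 n) p) q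

/-- The differential at `y` of the inverse of the preferred chart at `p`, as a map on `ℝⁿ`. -/
def chartSymmDeriv (p : M) (y : EuclideanSpace ℝ (Fin n)) :
    EuclideanSpace ℝ (Fin n) →L[ℝ] TangentSpace (𝓡 n) ((extChartAt (𝓡 n) p).symm y) :=
  mfderiv (𝓡 n) (𝓡 n) (extChartAt (𝓡 n) p).symm y

/-- The differential at `z` of a map `f : ℝᵐ → M`, as a map on `ℝᵐ`. -/
def paramDeriv (f : EuclideanSpace ℝ (Fin m) → M) (z : EuclideanSpace ℝ (Fin m)) :
    EuclideanSpace ℝ (Fin m) →L[ℝ] TangentSpace (𝓡 n) (f z) :=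
  mfderiv (𝓡 m) (𝓡 n) f z

/-- The expression of a self-map of `M` in the preferred chart at `p`. It is meaningful only where
`φ` stays inside the domain of the chart. -/
def chartMap (p : M) (φ : M → M) (y : EuclideanSpace ℝ (Fin n)) : EuclideanSpace ℝ (Fin n) :=
  extChartAt (𝓡 n) p (φ ((extChartAt (𝓡 n) p).symm y))

lemma chartMap_extChartAt_self {p : M} {φ : M → M} (hφp : φ p = p) :
    chartMap (n := n) p φ (extChartAt (𝓡 n) p p) = extChartAt (𝓡 n) p p := by
  rw [chartMap, extChartAt_to_inv, hφp]

variable [IsManifold (𝓡 n) ∞ M] {p q : M}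

lemma mdifferentiableAt_extChartAt_symm_of_mem_target {y : EuclideanSpace ℝ (Fin n)}
    (hy : y ∈ (extChartAt (𝓡 n) p).target) :
    MDifferentiableAt (𝓡 n) (𝓡 n) (extChartAt (𝓡 n) p).symm y := by
  have h := mdifferentiableWithinAt_extChartAt_symm (I := 𝓡 n) (x := p) hy
  rwa [ModelWithCorners.range_eq_univ, mdifferentiableWithinAt_univ] at h

lemma mdifferentiableAt_extChartAt_of_mem_source (hq : q ∈ (extChartAt (𝓡 n) p).source) :
    MDifferentiableAt (𝓡 n) (𝓡 n) (extChartAt (𝓡 n) p) q :=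
  mdifferentiableAt_extChartAt (by simpa using hq)

lemma chartDeriv_chartSymmDeriv {y : EuclideanSpace ℝ (Fin n)}
    (hy : y ∈ (extChartAt (𝓡 n) p).target) (u : EuclideanSpace ℝ (Fin n)) :
    chartDeriv p ((extChartAt (𝓡 n) p).symm y) (chartSymmDeriv p y u) = u := by
  have hcomp := mfderiv_extChartAt_comp_mfderivWithin_extChartAt_symm (I := 𝓡 n) (x := p) hy
  rw [ModelWithCorners.range_eq_univ, mfderivWithin_univ] at hcomp
  exact DFunLike.congr_fun hcomp u

lemma chartSymmDeriv_chartDeriv {y : EuclideanSpace ℝ (Fin n)}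
    (hy : y ∈ (extChartAt (𝓡 n) p).target)
    (v : TangentSpace (𝓡 n) ((extChartAt (𝓡 n) p).symm y)) :
    chartSymmDeriv p y (chartDeriv p ((extChartAt (𝓡 n) p).symm y) v) = v := by
  have hcomp := mfderivWithin_extChartAt_symm_comp_mfderiv_extChartAt (I := 𝓡 n) (x := p) hy
  rw [ModelWithCorners.range_eq_univ, mfderivWithin_univ] at hcomp
  exact DFunLike.congr_fun hcomp v

lemma isInvertible_chartDeriv (hq : q ∈ (extChartAt (𝓡 n) p).source) :
    (chartDeriv (n := n) p q).IsInvertible :=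
  isInvertible_mfderiv_extChartAt (I := 𝓡 n) hq

lemma hasFDerivAt_extChartAt_comp {f : EuclideanSpace ℝ (Fin m) → M}
    {z : EuclideanSpace ℝ (Fin m)} (hf : MDifferentiableAt (𝓡 m) (𝓡 n) f z)
    (hz : f z ∈ (extChartAt (𝓡 n) p).source) :
    HasFDerivAt (extChartAt (𝓡 n) p ∘ f) ((chartDeriv p (f z)).comp (paramDeriv f z)) z :=
  hasMFDerivAt_iff_hasFDerivAt.1
    ((mdifferentiableAt_extChartAt_of_mem_source hz).hasMFDerivAt.comp z hf.hasMFDerivAt)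

lemma contDiffAt_chartMap {φ : M → M} (hφ : ContMDiffAt (𝓡 n) (𝓡 n) ∞ φ p) (hφp : φ p = p) :
    ContDiffAt ℝ ∞ (chartMap (n := n) p φ) (extChartAt (𝓡 n) p p) := by
  have hsymm : ContMDiffAt (𝓡 n) (𝓡 n) ∞ (extChartAt (𝓡 n) p).symm (extChartAt (𝓡 n) p p) :=
    (contMDiffOn_extChartAt_symm p).contMDiffAt (extChartAt_target_mem_nhds p)
  have hchart : ContMDiffAt (𝓡 n) (𝓡 n) ∞ (extChartAt (𝓡 n) p) (φ p) := by
    rw [hφp]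
    exact contMDiffAt_extChartAt
  rw [← extChartAt_to_inv (I := 𝓡 n) p] at hφ
  have hφsymm := hφ.comp (extChartAt (𝓡 n) p p) hsymm
  refine contMDiffAt_iff_contDiffAt.1 (ContMDiffAt.comp (extChartAt (𝓡 n) p p) ?_ hφsymm)
  simpa only [Function.comp_apply, extChartAt_to_inv, hφp] using hchart

lemma hasFDerivAt_chartMap {φ : M → M} {y : EuclideanSpace ℝ (Fin n)}
    (hφ : MDifferentiableAt (𝓡 n) (𝓡 n) φ ((extChartAt (𝓡 n) p).symm y))
    (hy : y ∈ (extChartAt (𝓡 n) p).target)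
    (hφy : φ ((extChartAt (𝓡 n) p).symm y) ∈ (extChartAt (𝓡 n) p).source) :
    HasFDerivAt (chartMap p φ) ((chartDeriv p (φ ((extChartAt (𝓡 n) p).symm y))).comp
      ((mfderiv (𝓡 n) (𝓡 n) φ ((extChartAt (𝓡 n) p).symm y)).comp (chartSymmDeriv p y))) y :=
  hasMFDerivAt_iff_hasFDerivAt.1
    ((mdifferentiableAt_extChartAt_of_mem_source hφy).hasMFDerivAt.comp y
      (hφ.hasMFDerivAt.comp y (mdifferentiableAt_extChartAt_symm_of_mem_target hy).hasMFDerivAt))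

lemma fderiv_chartMap_chartDeriv {φ : M → M} (hφ : MDifferentiableAt (𝓡 n) (𝓡 n) φ q)
    (hq : q ∈ (extChartAt (𝓡 n) p).source) (hφq : φ q ∈ (extChartAt (𝓡 n) p).source)
    (v : TangentSpace (𝓡 n) q) :
    fderiv ℝ (chartMap p φ) (extChartAt (𝓡 n) p q) (chartDeriv p q v) =
      chartDeriv p (φ q) (mfderiv (𝓡 n) (𝓡 n) φ q v) := by
  obtain ⟨y, hy, rfl⟩ : ∃ y ∈ (extChartAt (𝓡 n) p).target, (extChartAt (𝓡 n) p).symm y = q :=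
    ⟨_, (extChartAt (𝓡 n) p).map_source hq, (extChartAt (𝓡 n) p).left_inv hq⟩
  rw [(extChartAt (𝓡 n) p).right_inv hy, (hasFDerivAt_chartMap hφ hy hφq).fderiv,
    ContinuousLinearMap.comp_apply, ContinuousLinearMap.comp_apply, chartSymmDeriv_chartDeriv hy]

lemma fderiv_chartMap_chartDeriv_eq_neg {φ : M → M} (hφ : MDifferentiableAt (𝓡 n) (𝓡 n) φ p)
    (hφp : φ p = p) {w : TangentSpace (𝓡 n) p}
    (hφw : tangentMap (𝓡 n) (𝓡 n) φ ⟨p, w⟩ = ⟨p, -w⟩) :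
    fderiv ℝ (chartMap p φ) (extChartAt (𝓡 n) p p) (chartDeriv p p w) = -chartDeriv p p w := by
  rw [fderiv_chartMap_chartDeriv hφ (mem_extChartAt_source p)
    (by rw [hφp]; exact mem_extChartAt_source p), ← map_neg]
  exact congrArg (fun t : TangentBundle (𝓡 n) M ↦ chartDeriv p t.proj t.snd) hφw

end ChartDerivative

section ChartForm

open Matrix

variable {n : ℕ} {M : Type*} [TopologicalSpace M] [ChartedSpace (EuclideanSpace ℝ (Fin n)) M]
  [Bundle.RiemannianBundle (fun p : M ↦ TangentSpace (𝓡 n) p)]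

/-- The Riemannian metric in the preferred chart at `p`, as a bilinear form on `ℝⁿ`; its matrix is
`chartMetric`. -/
def chartForm (p : M) (y : EuclideanSpace ℝ (Fin n)) :
    EuclideanSpace ℝ (Fin n) →L[ℝ] EuclideanSpace ℝ (Fin n) →L[ℝ] ℝ :=
  (innerSL ℝ).bilinearComp (chartSymmDeriv p y) (chartSymmDeriv p y)

lemma chartForm_apply (p : M) (y u v : EuclideanSpace ℝ (Fin n)) :
    chartForm p y u v = inner ℝ (chartSymmDeriv p y u) (chartSymmDeriv p y v) := rfl

lemma chartForm_symm (p : M) (y u v : EuclideanSpace ℝ (Fin n)) :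
    chartForm p y u v = chartForm p y v u := by
  rw [chartForm_apply, chartForm_apply, real_inner_comm]

lemma chartMetric_apply (p : M) (y : EuclideanSpace ℝ (Fin n)) (i j : Fin n) :
    chartMetric p y i j =
      chartForm p y (EuclideanSpace.single i 1) (EuclideanSpace.single j 1) := rfl

variable [IsManifold (𝓡 n) ∞ M]

lemma inner_eq_chartForm {p q : M} (hq : q ∈ (extChartAt (𝓡 n) p).source)
    (v w : TangentSpace (𝓡 n) q) :
    inner ℝ v w = chartForm p (extChartAt (𝓡 n) p q) (chartDeriv p q v) (chartDeriv p q w) := by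
  obtain ⟨y, hy, rfl⟩ : ∃ y ∈ (extChartAt (𝓡 n) p).target, (extChartAt (𝓡 n) p).symm y = q :=
    ⟨_, (extChartAt (𝓡 n) p).map_source hq, (extChartAt (𝓡 n) p).left_inv hq⟩
  rw [(extChartAt (𝓡 n) p).right_inv hy, chartForm_apply,
    chartSymmDeriv_chartDeriv hy, chartSymmDeriv_chartDeriv hy]

lemma isUnit_det_chartMetric {p : M} {y : EuclideanSpace ℝ (Fin n)}
    (hy : y ∈ (extChartAt (𝓡 n) p).target) : IsUnit (chartMetric p y).det := by
  have hinj : Function.Injective (chartSymmDeriv p y).toLinearMap :=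
    Function.LeftInverse.injective (chartDeriv_chartSymmDeriv hy)
  have hdet := (LinearMap.BilinForm.nondegenerate_iff_det_ne_zero
    (EuclideanSpace.basisFun (Fin n) ℝ).toBasis).1 (nondegenerate_innerPullback hinj)
  refine isUnit_iff_ne_zero.2 ?_
  convert hdet using 2
  ext i j
  simp only [LinearMap.BilinForm.toMatrix_apply, OrthonormalBasis.coe_toBasis,
    EuclideanSpace.basisFun_apply]
  rfl

lemma contDiffOn_chartForm
    [IsContMDiffRiemannianBundle (𝓡 n) ∞ (EuclideanSpace ℝ (Fin n))
      (fun p : M ↦ TangentSpace (𝓡 n) p)] (p : M) :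
    ContDiffOn ℝ ∞ (chartForm p) (extChartAt (𝓡 n) p).target := by
  have hopen : IsOpen (extChartAt (𝓡 n) p).target := isOpen_extChartAt_target p
  have hsection (u : EuclideanSpace ℝ (Fin n)) : ContMDiffOn (𝓡 n) (𝓡 n).tangent ∞
      (fun y ↦ (⟨(extChartAt (𝓡 n) p).symm y, chartSymmDeriv p y u⟩ : TangentBundle (𝓡 n) M))
      (extChartAt (𝓡 n) p).target := by
    have hsymm := contMDiffOn_extChartAt_symm (I := 𝓡 n) (n := ∞) p
    have htangent := hsymm.contMDiffOn_tangentMapWithin (m := ∞) (by simp) hopen.uniqueMDiffOn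
    have hconst : ContMDiff (𝓡 n) (𝓡 n).tangent ∞
        fun y ↦ (⟨y, u⟩ : TangentBundle (𝓡 n) (EuclideanSpace ℝ (Fin n))) := fun y ↦
      contMDiffAt_vectorSpace_iff_contDiffAt.2 contDiffAt_const
    refine (htangent.comp hconst.contMDiffOn fun y hy ↦ hy).congr fun y hy ↦ ?_
    simp only [Function.comp_apply, tangentMapWithin, mfderivWithin_of_isOpen hopen hy]
    rfl
  refine contDiffOn_clm_apply.2 fun u ↦ contDiffOn_clm_apply.2 fun v ↦ ?_
  exact contMDiffOn_iff_contDiffOn.1 ((hsection u).inner_bundle (hsection v))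

variable [IsContMDiffRiemannianBundle (𝓡 n) ∞ (EuclideanSpace ℝ (Fin n))
  (fun p : M ↦ TangentSpace (𝓡 n) p)] {p : M} {y : EuclideanSpace ℝ (Fin n)}

lemma differentiableAt_chartForm (hy : y ∈ (extChartAt (𝓡 n) p).target) :
    DifferentiableAt ℝ (chartForm p) y :=
  ((contDiffOn_chartForm p).contDiffAt ((isOpen_extChartAt_target p).mem_nhds hy)).differentiableAt
    (by simp)

lemma chartMetricDeriv_eq_fderiv_chartForm (hy : y ∈ (extChartAt (𝓡 n) p).target)
    (k i j : Fin n) :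
    chartMetricDeriv p y k i j = fderiv ℝ (chartForm p) y (EuclideanSpace.single k 1)
      (EuclideanSpace.single i 1) (EuclideanSpace.single j 1) := by
  have hentry := ((differentiableAt_chartForm hy).hasFDerivAt.clm_apply
    (hasFDerivAt_const (EuclideanSpace.single i (1 : ℝ)) y)).clm_apply
      (hasFDerivAt_const (EuclideanSpace.single j (1 : ℝ)) y)
  simp only [chartMetricDeriv, chartMetric_apply, hentry.fderiv]
  simp

lemma christoffelSymbol_eq_inv_mulVec (hy : y ∈ (extChartAt (𝓡 n) p).target) (k i j : Fin n) :
    christoffelSymbol p y k i j = ((chartMetric p y)⁻¹ *ᵥ fun l ↦ christoffelFirstKind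
      (chartForm p) y (EuclideanSpace.single i 1) (EuclideanSpace.single j 1)
        (EuclideanSpace.single l 1)) k := by
  simp only [christoffelSymbol, chartMetricDeriv_eq_fderiv_chartForm hy, Matrix.mulVec, dotProduct,
    christoffelFirstKind_apply, Finset.mul_sum]
  exact Finset.sum_congr rfl fun l _ ↦ by ring

lemma christoffel_eq_inv_mulVec (hy : y ∈ (extChartAt (𝓡 n) p).target)
    (u v : EuclideanSpace ℝ (Fin n)) :
    (christoffel p y u v).ofLp = (chartMetric p y)⁻¹ *ᵥ fun l ↦
      christoffelFirstKind (chartForm p) y u v (EuclideanSpace.single l 1) := by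
  have hexpand (l : Fin n) :
      christoffelFirstKind (chartForm p) y u v (EuclideanSpace.single l 1) =
        ∑ i, ∑ j, christoffelFirstKind (chartForm p) y (EuclideanSpace.single i 1)
          (EuclideanSpace.single j 1) (EuclideanSpace.single l 1) * u i * v j := by
    conv_lhs =>
      rw [← (EuclideanSpace.basisFun (Fin n) ℝ).sum_repr u,
        ← (EuclideanSpace.basisFun (Fin n) ℝ).sum_repr v]
    simp only [map_sum, map_smul, LinearMap.sum_apply, LinearMap.smul_apply, _root_.sum_apply,
      _root_.smul_apply, EuclideanSpace.basisFun_repr, EuclideanSpace.basisFun_apply, smul_eq_mul,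
      Finset.mul_sum]
    rw [Finset.sum_comm]
    exact Finset.sum_congr rfl fun i _ ↦ Finset.sum_congr rfl fun j _ ↦ by ring
  ext k
  simp only [christoffel, christoffelSymbol_eq_inv_mulVec hy, hexpand, Matrix.mulVec, dotProduct,
    Finset.mul_sum, Finset.sum_mul]
  rw [Finset.sum_comm_cycle]
  exact Finset.sum_congr rfl fun l _ ↦ Finset.sum_congr rfl fun i _ ↦
    Finset.sum_congr rfl fun j _ ↦ by ring

lemma chartForm_christoffel (hy : y ∈ (extChartAt (𝓡 n) p).target)
    (u v : EuclideanSpace ℝ (Fin n)) :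
    chartForm p y (christoffel p y u v) = christoffelFirstKind (chartForm p) y u v := by
  refine ContinuousLinearMap.coe_injective ((EuclideanSpace.basisFun (Fin n) ℝ).toBasis.ext
    fun l ↦ ?_)
  have hmulVec (c : EuclideanSpace ℝ (Fin n)) :
      chartForm p y c (EuclideanSpace.single l 1) = (chartMetric p y *ᵥ c.ofLp) l := by
    conv_lhs => rw [chartForm_symm, ← (EuclideanSpace.basisFun (Fin n) ℝ).sum_repr c]
    simp [Matrix.mulVec, dotProduct, chartMetric_apply, mul_comm]
  simp [hmulVec, christoffel_eq_inv_mulVec hy, Matrix.mulVec_mulVec,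
    Matrix.mul_nonsing_inv _ (isUnit_det_chartMetric hy)]

end ChartForm

section Isometry

variable {n : ℕ} {M : Type*} [TopologicalSpace M] [ChartedSpace (EuclideanSpace ℝ (Fin n)) M]
  [Bundle.RiemannianBundle (fun p : M ↦ TangentSpace (𝓡 n) p)] [IsManifold (𝓡 n) ∞ M]

lemma IsRiemannianIsometry.isLocalIsometryAt_chartMap {φ : M ≃ₘ⟮𝓡 n, 𝓡 n⟯ M}
    (hφ : IsRiemannianIsometry φ) {p : M} (hφp : φ p = p) :
    IsLocalIsometryAt (chartForm p) (chartForm p) (chartMap p φ) (extChartAt (𝓡 n) p p) := by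
  have hsource : ∀ᶠ y in 𝓝 (extChartAt (𝓡 n) p p),
      φ ((extChartAt (𝓡 n) p).symm y) ∈ (extChartAt (𝓡 n) p).source := by
    refine (φ.continuous.continuousAt.comp (continuousAt_extChartAt_symm p)).eventually_mem ?_
    rw [Function.comp_apply, extChartAt_to_inv, hφp]
    exact extChartAt_source_mem_nhds p
  filter_upwards [extChartAt_target_mem_nhds p, hsource] with y hy hφy u v
  rw [(hasFDerivAt_chartMap (φ.contMDiff.mdifferentiable (by simp) _) hy hφy).fderiv,
    chartForm_apply p y, ← hφ, inner_eq_chartForm hφy]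
  rfl

end Isometry

section Parametrization

variable {n m : ℕ} {M : Type*} [TopologicalSpace M] [ChartedSpace (EuclideanSpace ℝ (Fin n)) M]

namespace LocalParametrization

variable {S : Set M} (P : LocalParametrization (n := n) S m) {x : EuclideanSpace ℝ (Fin m)}

lemma mem_of_mem_domain (hx : x ∈ P.domain) : P.toFun x ∈ S := by
  obtain ⟨O, -, hPO⟩ := P.image_eq
  exact (hPO.subset (Set.mem_image_of_mem _ hx)).1

lemma continuousAt (hx : x ∈ P.domain) : ContinuousAt P.toFun x :=
  P.mdifferentiableOn.continuousOn.continuousAt (P.isOpen_domain.mem_nhds hx)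

lemma eventually_mdifferentiableAt (hx : x ∈ P.domain) :
    ∀ᶠ z in 𝓝 x, MDifferentiableAt (𝓡 m) (𝓡 n) P.toFun z := by
  filter_upwards [P.isOpen_domain.eventually_mem hx] with z hz
  exact P.mdifferentiableOn.mdifferentiableAt (P.isOpen_domain.mem_nhds hz)

lemma eventually_mem_range {c : EuclideanSpace ℝ (Fin m) → M} (hx : x ∈ P.domain)
    (hc : ContinuousAt c x) (hcS : ∀ᶠ z in 𝓝 x, c z ∈ S) (hcx : c x = P.toFun x) :
    ∀ᶠ z in 𝓝 x, c z ∈ Set.range (P.domain.domRestrict P.toFun) := by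
  obtain ⟨O, hO, hPO⟩ := P.image_eq
  have hxO : c x ∈ O := hcx ▸ (hPO.subset (Set.mem_image_of_mem _ hx)).2
  filter_upwards [hcS, hc.eventually_mem (hO.mem_nhds hxO)] with z hzS hzO
  rw [Set.range_domRestrict, hPO]
  exact ⟨hzS, hzO⟩

lemma exists_lift {c : EuclideanSpace ℝ (Fin m) → M} (hx : x ∈ P.domain)
    (hc : ContinuousAt c x) (hcS : ∀ᶠ z in 𝓝 x, c z ∈ S) (hcx : c x = P.toFun x) :
    ∃ θ : EuclideanSpace ℝ (Fin m) → EuclideanSpace ℝ (Fin m),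
      ContinuousAt θ x ∧ θ x = x ∧ P.toFun ∘ θ =ᶠ[𝓝 x] c := by
  have : Nonempty P.domain := ⟨⟨x, hx⟩⟩
  let θ := Function.invFun (P.domain.domRestrict P.toFun) ∘ c
  have hθ : P.domain.domRestrict P.toFun ∘ θ =ᶠ[𝓝 x] c :=
    (P.eventually_mem_range hx hc hcS hcx).mono fun _ hz ↦ Function.invFun_eq hz
  have hθx : θ x = ⟨x, hx⟩ := P.isEmbedding.injective (hθ.self_of_nhds.trans hcx)
  have hθc : ContinuousAt θ x :=
    P.isEmbedding.isInducing.continuousAt_iff.2 (hc.congr hθ.symm)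
  exact ⟨Subtype.val ∘ θ, continuous_subtype_val.continuousAt.comp hθc,
    congrArg Subtype.val hθx, hθ⟩

variable [IsManifold (𝓡 n) ∞ M]

lemma twiceDifferentiableAt_extChartAt_comp (hx : x ∈ P.domain) :
    TwiceDifferentiableAt (extChartAt (𝓡 n) (P.toFun x) ∘ P.toFun) x where
  eventually_differentiableAt := by
    filter_upwards [P.eventually_mdifferentiableAt hx,
      (P.continuousAt hx).eventually_mem
        (extChartAt_source_mem_nhds (I := 𝓡 n) (P.toFun x))] with z hz hz'
    exact (hasFDerivAt_extChartAt_comp hz hz').differentiableAt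
  differentiableAt_fderiv := P.differentiableAt_fderiv x hx

lemma fderiv_extChartAt_comp (hx : x ∈ P.domain) :
    fderiv ℝ (extChartAt (𝓡 n) (P.toFun x) ∘ P.toFun) x =
      (chartDeriv (P.toFun x) (P.toFun x)).comp (paramDeriv P.toFun x) :=
  (hasFDerivAt_extChartAt_comp (P.eventually_mdifferentiableAt hx).self_of_nhds
    (mem_extChartAt_source _)).fderiv

lemma injective_fderiv_extChartAt_comp (hx : x ∈ P.domain) :
    Function.Injective (fderiv ℝ (extChartAt (𝓡 n) (P.toFun x) ∘ P.toFun) x) := by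
  rw [P.fderiv_extChartAt_comp hx]
  exact (isInvertible_chartDeriv (mem_extChartAt_source _)).injective.comp
    (P.injective_mfderiv x hx)

end LocalParametrization

end Parametrization

section Transition

variable {n m : ℕ} {M : Type*} [TopologicalSpace M] [ChartedSpace (EuclideanSpace ℝ (Fin n)) M]
  [IsManifold (𝓡 n) ∞ M]

lemma LocalParametrization.exists_hasFDerivAt_transition {S : Set M}
    (P : LocalParametrization (n := n) S m) {x : EuclideanSpace ℝ (Fin m)} (hx : x ∈ P.domain)
    {φ : M → M} (hφ : MDifferentiableAt (𝓡 n) (𝓡 n) φ (P.toFun x)) (hφS : Set.MapsTo φ S S)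
    (hφx : φ (P.toFun x) = P.toFun x) :
    ∃ (θ : EuclideanSpace ℝ (Fin m) → EuclideanSpace ℝ (Fin m))
      (A : EuclideanSpace ℝ (Fin m) →L[ℝ] EuclideanSpace ℝ (Fin m)),
      HasFDerivAt θ A x ∧ θ x = x ∧
      (extChartAt (𝓡 n) (P.toFun x) ∘ P.toFun) ∘ θ =ᶠ[𝓝 x]
        chartMap (P.toFun x) φ ∘ extChartAt (𝓡 n) (P.toFun x) ∘ P.toFun := by
  set F := extChartAt (𝓡 n) (P.toFun x) ∘ P.toFun
  have hF : DifferentiableAt ℝ F x := (P.twiceDifferentiableAt_extChartAt_comp hx).differentiableAt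
  obtain ⟨θ, hθc, hθx, hθ⟩ := P.exists_lift hx (hφ.continuousAt.comp (P.continuousAt hx))
    (P.isOpen_domain.eventually_mem hx |>.mono fun _ hz ↦ hφS (P.mem_of_mem_domain hz)) hφx
  have hFθ : F ∘ θ =ᶠ[𝓝 x] chartMap (P.toFun x) φ ∘ F := by
    filter_upwards [hθ, (P.continuousAt hx).eventually_mem
      (extChartAt_source_mem_nhds (I := 𝓡 n) (P.toFun x))] with z hz hz'
    simp only [Function.comp_apply] at hz
    simp only [F, chartMap, Function.comp_apply, hz, (extChartAt (𝓡 n) (P.toFun x)).left_inv hz']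
  have hφF : DifferentiableAt ℝ (chartMap (P.toFun x) φ ∘ F) x := by
    refine DifferentiableAt.comp x (hasFDerivAt_chartMap ?_ ?_ ?_).differentiableAt hF
    · simpa only [F, Function.comp_apply, extChartAt_to_inv] using hφ
    · exact mem_extChartAt_target _
    · simp only [F, Function.comp_apply, extChartAt_to_inv, hφx, mem_extChartAt_source]
  obtain ⟨L, hL⟩ := (fderiv ℝ F x).toLinearMap.exists_leftInverse_of_injective
    (LinearMap.ker_eq_bot.2 (P.injective_fderiv_extChartAt_comp hx))
  refine ⟨θ, _, hasFDerivAt_of_comp_of_leftInverse (L := L.toContinuousLinearMap)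
    (by rw [hθx]; exact hF.hasFDerivAt) (ContinuousLinearMap.ext fun v ↦ DFunLike.congr_fun hL v)
    (hφF.hasFDerivAt.congr_of_eventuallyEq hFθ) hθc, hθx, hFθ⟩

end Transition

section MeanCurvature

variable {n m : ℕ} {M : Type*} [TopologicalSpace M] [ChartedSpace (EuclideanSpace ℝ (Fin n)) M]
  [Bundle.RiemannianBundle (fun p : M ↦ TangentSpace (𝓡 n) p)]

lemma meanCurvatureVector_mem_orthogonal (f : EuclideanSpace ℝ (Fin m) → M)
    (x : EuclideanSpace ℝ (Fin m)) :
    meanCurvatureVector (n := n) f x ∈ (tangentSubspace (n := n) f x)ᗮ :=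
  Submodule.sum_mem _ fun _ _ ↦ Submodule.sum_mem _ fun _ _ ↦ Submodule.smul_mem _ _
    (Submodule.starProjection_apply_mem _ _)

lemma inducedMetric_eq_toMatrix (f : EuclideanSpace ℝ (Fin m) → M)
    (x : EuclideanSpace ℝ (Fin m)) :
    inducedMetric (n := n) f x =
      LinearMap.BilinForm.toMatrix (EuclideanSpace.basisFun (Fin m) ℝ).toBasis
        (innerPullback (paramDeriv (n := n) f x).toLinearMap) := by
  ext i j
  simp only [LinearMap.BilinForm.toMatrix_apply, OrthonormalBasis.coe_toBasis,
    EuclideanSpace.basisFun_apply]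
  rfl

variable [IsManifold (𝓡 n) ∞ M] {S : Set M} (P : LocalParametrization (n := n) S m)
  {x : EuclideanSpace ℝ (Fin m)}

lemma LocalParametrization.chartDeriv_covariantDerivAlong (hx : x ∈ P.domain)
    (a b : EuclideanSpace ℝ (Fin m)) :
    chartDeriv (P.toFun x) (P.toFun x) (covariantDerivAlong P.toFun (paramDeriv P.toFun · b) x a) =
      fderiv ℝ (fderiv ℝ (extChartAt (𝓡 n) (P.toFun x) ∘ P.toFun)) x a b +
        christoffel (P.toFun x) (extChartAt (𝓡 n) (P.toFun x) (P.toFun x))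
          (fderiv ℝ (extChartAt (𝓡 n) (P.toFun x) ∘ P.toFun) x a)
          (fderiv ℝ (extChartAt (𝓡 n) (P.toFun x) ∘ P.toFun) x b) := by
  set F := extChartAt (𝓡 n) (P.toFun x) ∘ P.toFun
  have hfield : (fun z ↦ chartDeriv (P.toFun x) (P.toFun z) (paramDeriv P.toFun z b)) =ᶠ[𝓝 x]
      fun z ↦ fderiv ℝ F z b := by
    filter_upwards [P.eventually_mdifferentiableAt hx, (P.continuousAt hx).eventually_mem
      (extChartAt_source_mem_nhds (I := 𝓡 n) (P.toFun x))] with z hz hz'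
    rw [(hasFDerivAt_extChartAt_comp hz hz').fderiv]
    rfl
  have hfderiv : fderiv ℝ (fun z ↦ chartDeriv (P.toFun x) (P.toFun z) (paramDeriv P.toFun z b)) x a
      = fderiv ℝ (fderiv ℝ F) x a b := by
    rw [hfield.fderiv_eq, ((P.differentiableAt_fderiv x hx).hasFDerivAt.clm_apply
      (hasFDerivAt_const b x)).fderiv]
    simp [F]
  have hfield_x : chartDeriv (P.toFun x) (P.toFun x) (paramDeriv P.toFun x b) = fderiv ℝ F x b :=
    hfield.self_of_nhds
  rw [← hfderiv, ← hfield_x]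
  exact (isInvertible_chartDeriv (mem_extChartAt_source _)).self_apply_inverse _

variable [IsContMDiffRiemannianBundle (𝓡 n) ∞ (EuclideanSpace ℝ (Fin n))
  (fun p : M ↦ TangentSpace (𝓡 n) p)]

lemma LocalParametrization.inner_secondFundamentalForm (hx : x ∈ P.domain)
    {w : TangentSpace (𝓡 n) (P.toFun x)} (hw : w ∈ (tangentSubspace (n := n) P.toFun x)ᗮ)
    (a b : EuclideanSpace ℝ (Fin m)) :
    inner ℝ w (secondFundamentalForm (n := n) P.toFun x a b) =
      covariantHessian (chartForm (P.toFun x)) (extChartAt (𝓡 n) (P.toFun x) ∘ P.toFun) x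
        (chartDeriv (P.toFun x) (P.toFun x) w) a b := by
  have hsource := mem_extChartAt_source (I := 𝓡 n) (P.toFun x)
  have hcov := P.chartDeriv_covariantDerivAlong hx a b
  rw [secondFundamentalForm, ← Submodule.inner_starProjection_left_eq_right,
    Submodule.starProjection_eq_self_iff.2 hw, inner_eq_chartForm hsource]
  refine (congrArg _ hcov).trans ?_
  rw [covariantHessian_apply, map_add, Function.comp_apply,
    ← chartForm_christoffel (mem_extChartAt_target _), chartForm_symm _ _ (christoffel _ _ _ _)]

end MeanCurvature

section Reversal

variable {n m : ℕ} {M : Type*} [TopologicalSpace M] [ChartedSpace (EuclideanSpace ℝ (Fin n)) M]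
  [IsManifold (𝓡 n) ∞ M] [Bundle.RiemannianBundle (fun p : M ↦ TangentSpace (𝓡 n) p)]
  {S : Set M} (P : LocalParametrization (n := n) S m) {x : EuclideanSpace ℝ (Fin m)}

namespace LocalParametrization

lemma chartForm_chartDeriv_fderiv_eq_zero (hx : x ∈ P.domain)
    {w : TangentSpace (𝓡 n) (P.toFun x)} (hw : w ∈ (tangentSubspace (n := n) P.toFun x)ᗮ)
    (a : EuclideanSpace ℝ (Fin m)) :
    chartForm (P.toFun x) (extChartAt (𝓡 n) (P.toFun x) (P.toFun x))
      (chartDeriv (P.toFun x) (P.toFun x) w)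
      (fderiv ℝ (extChartAt (𝓡 n) (P.toFun x) ∘ P.toFun) x a) = 0 := by
  rw [P.fderiv_extChartAt_comp hx, ContinuousLinearMap.comp_apply,
    ← inner_eq_chartForm (mem_extChartAt_source _)]
  exact Submodule.inner_left_of_mem_orthogonal (LinearMap.mem_range_self _ a) hw

lemma innerPullback_paramDeriv_apply (hx : x ∈ P.domain) (u v : EuclideanSpace ℝ (Fin m)) :
    innerPullback (paramDeriv (n := n) P.toFun x).toLinearMap u v =
      chartForm (P.toFun x) (extChartAt (𝓡 n) (P.toFun x) (P.toFun x))
        (fderiv ℝ (extChartAt (𝓡 n) (P.toFun x) ∘ P.toFun) x u)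
        (fderiv ℝ (extChartAt (𝓡 n) (P.toFun x) ∘ P.toFun) x v) := by
  rw [innerPullback_apply, inner_eq_chartForm (mem_extChartAt_source _),
    P.fderiv_extChartAt_comp hx]
  rfl

variable [IsContMDiffRiemannianBundle (𝓡 n) ∞ (EuclideanSpace ℝ (Fin n))
  (fun p : M ↦ TangentSpace (𝓡 n) p)]

lemma inner_meanCurvatureVector (hx : x ∈ P.domain)
    {w : TangentSpace (𝓡 n) (P.toFun x)} (hw : w ∈ (tangentSubspace (n := n) P.toFun x)ᗮ) :
    inner ℝ w (meanCurvatureVector (n := n) P.toFun x) =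
      Matrix.trace ((inducedMetric (n := n) P.toFun x)⁻¹ * LinearMap.BilinForm.toMatrix
        (EuclideanSpace.basisFun (Fin m) ℝ).toBasis
        (covariantHessian (chartForm (P.toFun x)) (extChartAt (𝓡 n) (P.toFun x) ∘ P.toFun) x
          (chartDeriv (P.toFun x) (P.toFun x) w))) := by
  have hsymm : (inducedMetric (n := n) P.toFun x).IsSymm := by
    rw [inducedMetric_eq_toMatrix, LinearMap.BilinForm.isSymm_toMatrix_iff_isSymm]
    exact isSymm_innerPullback _
  rw [← Matrix.trace_transpose, Matrix.transpose_mul, hsymm.inv.eq, Matrix.trace_mul_comm,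
    ← Matrix.sum_hadamard_eq, meanCurvatureVector, inner_sum]
  simp only [inner_sum, real_inner_smul_right, P.inner_secondFundamentalForm hx hw,
    Matrix.hadamard_apply, LinearMap.BilinForm.toMatrix_apply, OrthonormalBasis.coe_toBasis,
    EuclideanSpace.basisFun_apply]

lemma inner_meanCurvatureVector_eq_zero (hx : x ∈ P.domain) {φ : M ≃ₘ⟮𝓡 n, 𝓡 n⟯ M}
    (hφ : IsRiemannianIsometry φ) (hφx : φ (P.toFun x) = P.toFun x) (hφS : Set.MapsTo φ S S)
    {w : TangentSpace (𝓡 n) (P.toFun x)} (hw : w ∈ (tangentSubspace (n := n) P.toFun x)ᗮ)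
    (hφw : tangentMap (𝓡 n) (𝓡 n) φ ⟨P.toFun x, w⟩ = ⟨P.toFun x, -w⟩) :
    inner ℝ w (meanCurvatureVector (n := n) P.toFun x) = 0 := by
  have hφd : MDifferentiableAt (𝓡 n) (𝓡 n) φ (P.toFun x) := φ.contMDiff.mdifferentiable (by simp) _
  have hF := P.twiceDifferentiableAt_extChartAt_comp hx
  have hΦ : TwiceDifferentiableAt (chartMap (P.toFun x) φ) (extChartAt (𝓡 n) _ (P.toFun x)) :=
    .of_contDiffAt (contDiffAt_infty.1 (contDiffAt_chartMap φ.contMDiff.contMDiffAt hφx) 2)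
  have hisom := hφ.isLocalIsometryAt_chartMap hφx
  have hΦx := chartMap_extChartAt_self (n := n) hφx
  have hΦw := fderiv_chartMap_chartDeriv_eq_neg hφd hφx hφw
  obtain ⟨θ, A, hθ, hθx, hFθ⟩ := P.exists_hasFDerivAt_transition hx hφd hφS hφx
  rw [P.inner_meanCurvatureVector hx hw, inducedMetric_eq_toMatrix]
  refine trace_inv_toMatrix_mul_toMatrix_eq_zero _ (A := A.toLinearMap) (isSymm_innerPullback _)
    (nondegenerate_innerPullback (P.injective_mfderiv x hx)) (fun u v ↦ ?_) fun v ↦ ?_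
  · rw [P.innerPullback_paramDeriv_apply hx, P.innerPullback_paramDeriv_apply hx]
    exact hisom.apply_fderiv_of_semiconj (F := extChartAt (𝓡 n) (P.toFun x) ∘ P.toFun)
      hΦ.differentiableAt hF.differentiableAt hΦx hθ hθx hFθ u v
  · exact covariantHessian_neg_of_isometry (F := extChartAt (𝓡 n) (P.toFun x) ∘ P.toFun)
      hisom hΦ hF (differentiableAt_chartForm (mem_extChartAt_target _)) (chartForm_symm _ _) hΦx
      hΦw (P.chartForm_chartDeriv_fderiv_eq_zero hx hw) hθ hθx hFθ v

end LocalParametrization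

end Reversal

end Helicoidal

end

theorem theorem2_general {n m : ℕ} {M : Type*} [TopologicalSpace M]
    [ChartedSpace (EuclideanSpace ℝ (Fin n)) M] [IsManifold (𝓡 n) ∞ M]
    [Bundle.RiemannianBundle (fun p : M ↦ TangentSpace (𝓡 n) p)]
    [IsContMDiffRiemannianBundle (𝓡 n) ∞ (EuclideanSpace ℝ (Fin n))
      (fun p : M ↦ TangentSpace (𝓡 n) p)]
    {S : Set M} {p : M} {φ : M ≃ₘ⟮𝓡 n, 𝓡 n⟯ M} (hφ : Helicoidal.IsRiemannianIsometry φ)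
    (hφp : φ p = p) (hφS : Set.MapsTo φ S S)
    (hneg : ∀ (P : Helicoidal.LocalParametrization (n := n) S m), ∀ x ∈ P.domain, P.toFun x = p →
      ∀ v ∈ (Helicoidal.tangentSubspace (n := n) P.toFun x)ᗮ,
        tangentMap (𝓡 n) (𝓡 n) φ ⟨P.toFun x, v⟩ = ⟨P.toFun x, -v⟩) :
    Helicoidal.IsMinimalAt (n := n) S m p := by
  rintro P x hx rfl
  have hH := Helicoidal.meanCurvatureVector_mem_orthogonal (n := n) P.toFun x
  exact inner_self_eq_zero.1 <|
    P.inner_meanCurvatureVector_eq_zero hx hφ hφp hφS hH (hneg P x hx rfl _ hH)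

theorem theorem2 {n m : ℕ} {M : Type*} [TopologicalSpace M] [T2Space M]
    [ChartedSpace (EuclideanSpace ℝ (Fin n)) M] [IsManifold (𝓡 n) ∞ M]
    [Bundle.RiemannianBundle (fun p : M ↦ TangentSpace (𝓡 n) p)]
    [IsContMDiffRiemannianBundle (𝓡 n) ∞ (EuclideanSpace ℝ (Fin n))
      (fun p : M ↦ TangentSpace (𝓡 n) p)]
    (S : Set M) (hS : Helicoidal.IsHelicoidal (n := n) S m) :
    ∀ p ∈ Helicoidal.regularPart (n := n) S m, Helicoidal.IsMinimalAt (n := n) S m p := by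
  rintro p ⟨P, x, hx, rfl⟩
  obtain ⟨φ, hφ, hφp, hφS, hneg⟩ := hS _ (P.mem_of_mem_domain hx)
  exact theorem2_general hφ hφp (Set.mapsTo_iff_image_subset.2 hφS.subset) hneg
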